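/- Let $G$ be a topological group and let $X$ be a compact Hausdorff space with a continuous action $G\times X\to X$ that is minimal, i.e. every orbit $Gx$ is dense in $X$. For $n\ge 1$ let $\mathcal{HK}^{[n]}$ be the subgroup of $G^{\{0,1\}^n}$ generated by the elements $[h]_F$, where $h\in G$, $F=\{\omega\in\{0,1\}^n:\omega_i=a\}$ for some $1\le i\le n$ and $a\in\{0,1\}$, and $[h]_F(\omega)=h$ for $\omega\in F$, $[h]_F(\omega)=1_G$ for $\omega\notin F$. Let $$C_G^{[n]}(X)=\overline{\{(\gamma(\omega)x)_{\omega\in\{0,1\}^n}:\gamma\in\mathcal{HK}^{[n]},\ x\in X\}}\subseteq X^{\{0,1\}^n},$$ the closure being taken in the product topology. For $d\ge 1$ let $\mathrm{NRP}^{[d]}(X)$ be the set of pairs $(x,y)\in X\times X$ such that the configuration in $X^{\{0,1\}^{d+1}}$ with value $y$ at $(1,\dots,1)$ and value $x$ at every other vertex belongs to $C_G^{[d+1]}(X)$. Then for every $d\ge 1$, $\mathrm{NRP}^{[d]}(X)$ is a closed subset of $X\times X$, is invariant under the diagonal action of $G$, and is an equivalence relation on $X$. -/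

import Mathlib

namespace NilpotentRP

/-- The vertex set `{0,1}^d` of the discrete cube; `true` stands for `1`, `false` for `0`. -/
abbrev Cube (d : ℕ) : Type := Fin d → Bool

/-- A hyperface of `{0,1}^d` is a face of codimension one: a single coordinate is prescribed. -/
def IsHyperface {d : ℕ} (F : Set (Cube d)) : Prop :=
  ∃ (i : Fin d) (a : Bool), F = {ω : Cube d | ω i = a}

/-- The element `[h]_F` of `G^[d]`: the value is `h` at the vertices in `F` and `1` elsewhere. -/
noncomputable def faceElement {G : Type*} [Group G] {d : ℕ} (h : G) (F : Set (Cube d)) :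
    Cube d → G :=
  F.mulIndicator fun _ => h

/-- The Host-Kra cube group `HK^[d]` of `G`: the subgroup of `G^[d]` generated by all `[h]_F`,
for `h` in `G` and `F` a hyperface of `{0,1}^d`. -/
def hostKraGroup (G : Type*) [Group G] (d : ℕ) : Subgroup (Cube d → G) :=
  Subgroup.closure {γ | ∃ (h : G) (F : Set (Cube d)), IsHyperface F ∧ γ = faceElement h F}

/-- The dynamical cubes `C_G^[d](X)`: the closure, in the product topology of `X^[d]`, of the set
of all configurations `γ x^[d]`, where `γ` lies in `HK^[d]` and `x^[d]` is a constant configuration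
(`G^[d]` acts coordinatewise on `X^[d]`). -/
def dynamicalCubes (G X : Type*) [Group G] [TopologicalSpace X] [MulAction G X] (d : ℕ) :
    Set (Cube d → X) :=
  closure {c | ∃ γ ∈ hostKraGroup G d, ∃ x : X, c = fun ω => γ ω • x}

/-- The lower corner: the configuration with value `y` at the vertex `(1,…,1)` and value `x` at
all other vertices. -/
def lowerCorner {X : Type*} (d : ℕ) (x y : X) : Cube d → X :=
  Function.update (fun _ => x) (fun _ => true) y

/-- The nilpotent regionally proximal relation of order `d`, as a subset of `X × X`. -/
def NRP (G X : Type*) [Group G] [TopologicalSpace X] [MulAction G X] (d : ℕ) : Set (X × X) :=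
  {p | lowerCorner (d + 1) p.1 p.2 ∈ dynamicalCubes G X (d + 1)}

end NilpotentRP

/-! Symmetry and transitivity become group laws inside an Ellis semigroup. Let `L` be a minimal
closed left ideal of the enveloping semigroup of `X`, and `u` an idempotent of `L`; then `uL` is a
group with identity `u`. The same holds for elements of the enveloping semigroup of the Host-Kra
group whose coordinates all lie in `uL` (`exists_inverse`). Minimality of the action moves any
dynamical cube back to a constant configuration `y`. If `y` and `z` are fixed by `u`, the corner
with values `y`, `z` is thus `P • y` with coordinates of `P` in `uL`. Folding the cube by `ω ↦ ω ⊓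
η` and dividing by the folded element, one vertex at a time, makes `P` equal to `u` off the top
vertex (`exists_eq_idempotent_of_fixes`). So the relation on `u`-fixed points is the orbit relation
of a group of elements `q`, placed at the top vertex. Finally `lowerCorner_mem_iff_idempotent_smul`
reduces arbitrary points to `u`-fixed ones. -/

open Set Topology

namespace NilpotentRP

/-! ### Minimal left ideals in compact right topological monoids. -/

section RightTopologicalMonoid

variable {M : Type*} [Monoid M] [TopologicalSpace M]

/-- The closure of a submonoid `S` of a right topological monoid, provided that left
multiplication by elements of `S` is continuous. -/
def closureSubmonoid (hr : ∀ r : M, Continuous (· * r)) (S : Submonoid M)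
    (hl : ∀ s ∈ S, Continuous (s * ·)) : Submonoid M where
  carrier := closure (S : Set M)
  one_mem' := subset_closure S.one_mem
  mul_mem' := by
    intro a b ha hb
    have h1 : ∀ s ∈ S, s * b ∈ closure (S : Set M) := fun s hs =>
      map_mem_closure (hl s hs) hb fun t ht => S.mul_mem hs ht
    have h2 := map_mem_closure (t := closure (S : Set M)) (hr b) ha h1
    rwa [closure_closure] at h2

/-- `L` is a minimal closed left ideal of the submonoid `S`. -/
structure IsMinimalLeftIdeal (S : Submonoid M) (L : Set M) : Prop where
  subset : L ⊆ S
  isClosed : IsClosed L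
  nonempty : L.Nonempty
  mul_mem : ∀ p ∈ S, ∀ q ∈ L, p * q ∈ L
  exists_mul_eq : ∀ p ∈ L, ∀ q ∈ L, ∃ r ∈ S, r * p = q

theorem exists_isMinimalLeftIdeal [CompactSpace M] [T2Space M]
    (hr : ∀ r : M, Continuous (· * r)) (S : Submonoid M) (hS : IsClosed (S : Set M)) :
    ∃ L, IsMinimalLeftIdeal S L := by
  let I : Set (Set M) := {L | L ⊆ S ∧ IsClosed L ∧ L.Nonempty ∧ ∀ p ∈ S, ∀ q ∈ L, p * q ∈ L}
  obtain ⟨L, -, hL⟩ : ∃ L, L ⊆ (S : Set M) ∧ Minimal (· ∈ I) L := by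
    refine zorn_superset_nonempty I (fun c hcI hc hne => ?_) S
      ⟨subset_rfl, hS, ⟨1, S.one_mem⟩, fun p hp q hq => S.mul_mem hp hq⟩
    refine ⟨⋂₀ c, ⟨?_, isClosed_sInter fun t ht => (hcI ht).2.1, ?_, ?_⟩,
      fun s hs => sInter_subset_of_mem hs⟩
    · obtain ⟨t, ht⟩ := hne
      exact (sInter_subset_of_mem ht).trans (hcI ht).1
    · rw [sInter_eq_iInter]
      have := hne.coe_sort
      exact IsCompact.nonempty_iInter_of_directed_nonempty_isCompact_isClosed _
        (DirectedOn.directed_val (IsChain.directedOn hc.symm)) (fun i => (hcI i.2).2.2.1)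
        (fun i => (hcI i.2).2.1.isCompact) (fun i => (hcI i.2).2.1)
    · exact fun p hp q hq => mem_sInter.2 fun t ht =>
        (hcI ht).2.2.2 p hp q (mem_sInter.1 hq t ht)
  obtain ⟨hsub, hcl, hne, hmul⟩ := hL.prop
  refine ⟨L, hsub, hcl, hne, hmul, fun p hp q hq => ?_⟩
  -- The left ideal `S * p` is closed, being a compact image, and lies in `L`; minimality forces
  -- equality.
  have hmem : (· * p) '' (S : Set M) ∈ I := by
    refine ⟨?_, (hr p).isClosedMap _ hS, ⟨_, 1, S.one_mem, rfl⟩, ?_⟩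
    · rintro _ ⟨r, hrS, rfl⟩
      exact S.mul_mem hrS (hsub hp)
    · rintro s hs _ ⟨r, hrS, rfl⟩
      exact ⟨s * r, S.mul_mem hs hrS, mul_assoc _ _ _⟩
  have heq := hL.eq_of_subset hmem (by rintro _ ⟨r, hrS, rfl⟩; exact hmul r hrS p hp)
  rwa [← heq] at hq

/-- Minimality gives `p = r * u`, and `u` absorbs itself on the right. -/
theorem IsMinimalLeftIdeal.mul_idempotent {S : Submonoid M} {L : Set M}
    (hL : IsMinimalLeftIdeal S L) {u p : M} (hu : u ∈ L) (huu : u * u = u) (hp : p ∈ L) :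
    p * u = p := by
  obtain ⟨r, -, rfl⟩ := hL.exists_mul_eq u hu p hp
  rw [mul_assoc, huu]

end RightTopologicalMonoid

section Envelope

section Corner

variable {X : Type*}

theorem smul_lowerCorner {d : ℕ} (P : Cube d → Function.End X) (x y : X) (p q : Function.End X)
    (hP : P = Function.update (fun _ => p) (fun _ => true) q) :
    P • lowerCorner d x y = lowerCorner d (p • x) (q • y) := by
  subst hP
  funext ω
  by_cases h : ω = fun _ => true
  · subst h; simp [lowerCorner]
  · simp [lowerCorner, h]

theorem smul_const_eq_lowerCorner {d : ℕ} (x : X) (p q : Function.End X) :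
    (Function.update (fun _ => p) (fun _ => true) q : Cube d → Function.End X) • (fun _ => x) =
      lowerCorner d (p • x) (q • x) := by
  rw [← smul_lowerCorner _ x x p q rfl]
  exact congrArg _ (Function.update_eq_self (fun _ : Fin d => true) fun _ => x).symm

end Corner

instance {X : Type*} [TopologicalSpace X] : TopologicalSpace (Function.End X) :=
  inferInstanceAs (TopologicalSpace (X → X))

instance {X : Type*} [TopologicalSpace X] [CompactSpace X] : CompactSpace (Function.End X) :=
  inferInstanceAs (CompactSpace (X → X))

instance {X : Type*} [TopologicalSpace X] [T2Space X] : T2Space (Function.End X) :=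
  inferInstanceAs (T2Space (X → X))

variable {G X : Type*} [Group G] [TopologicalSpace X] [MulAction G X]

theorem continuous_end_smul (x : X) : Continuous fun p : Function.End X => p • x :=
  continuous_apply (A := fun _ : X => X) x

theorem continuous_end_mul_right (r : Function.End X) : Continuous (· * r) :=
  continuous_pi (A := fun _ : X => X) fun x => continuous_end_smul (r x)

theorem continuous_toEndHom_mul [ContinuousConstSMul G X] (g : G) :
    Continuous (MulAction.toEndHom (α := X) g * ·) :=
  continuous_pi (A := fun _ : X => X) fun x => (continuous_const_smul g).comp (continuous_end_smul x)

theorem continuous_pi_mul_right {ι : Type*} (r : ι → Function.End X) : Continuous (· * r) :=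
  continuous_pi fun i => (continuous_end_mul_right (r i)).comp (continuous_apply i)

theorem continuous_pi_smul {ι : Type*} (c : ι → X) :
    Continuous fun P : ι → Function.End X => P • c :=
  continuous_pi fun i => (continuous_end_smul (c i)).comp (continuous_apply i)

theorem const_mem_dynamicalCubes (d : ℕ) (x : X) : (fun _ => x) ∈ dynamicalCubes G X d :=
  subset_closure ⟨1, one_mem _, x, by simp⟩

theorem eq_univ_of_isClosed_of_smul_mem [MulAction.IsMinimal G X] {A : Set X} (hA : IsClosed A)
    (hne : A.Nonempty)
    (h : ∀ (g : G), ∀ x ∈ A, g • x ∈ A) : A = univ := by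
  obtain ⟨x, hx⟩ := hne
  rw [← hA.closure_eq]
  refine ((MulAction.IsMinimal.dense_orbit (M := G) x).mono ?_).closure_eq
  rintro _ ⟨g, rfl⟩
  exact h g x hx

/-! ### Enveloping semigroups of `G` and of the Host-Kra group. -/

variable (G X)

/-- The action of `G^ι` on `X^ι`, as a homomorphism to the monoid of families of self-maps. -/
def piToEnd (ι : Type*) : (ι → G) →* (ι → Function.End X) :=
  MonoidHom.pi fun i => (MulAction.toEndHom (α := X)).comp (Pi.evalMonoidHom _ i)

variable [ContinuousConstSMul G X]

/-- The Ellis semigroup of the action of `G` on `X`. -/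
def envelope : Submonoid (Function.End X) :=
  closureSubmonoid continuous_end_mul_right (MonoidHom.mrange (MulAction.toEndHom (M := G) (α := X)))
    (by rintro _ ⟨g, rfl⟩; exact continuous_toEndHom_mul g)

/-- The Ellis semigroup of the action of the Host-Kra cube group on `X^[d]`; its elements act
coordinatewise. -/
def cubeEnvelope (d : ℕ) : Submonoid (Cube d → Function.End X) :=
  closureSubmonoid continuous_pi_mul_right ((hostKraGroup G d).toSubmonoid.map (piToEnd G X (Cube d)))
    (by
      rintro _ ⟨γ, -, rfl⟩
      exact continuous_pi fun ω => (continuous_toEndHom_mul (γ ω)).comp (continuous_apply ω))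

variable {G X}

theorem isClosed_envelope : IsClosed (envelope G X : Set (Function.End X)) :=
  isClosed_closure

theorem isClosed_cubeEnvelope (d : ℕ) :
    IsClosed (cubeEnvelope G X d : Set (Cube d → Function.End X)) :=
  isClosed_closure

theorem map_mem_cubeEnvelope {d : ℕ} {f : Function.End X → Cube d → Function.End X}
    (hf : Continuous f)
    (h : ∀ g : G, ∃ γ ∈ hostKraGroup G d, f (MulAction.toEndHom g) = piToEnd G X (Cube d) γ)
    {p : Function.End X} (hp : p ∈ envelope G X) : f p ∈ cubeEnvelope G X d := by
  refine map_mem_closure hf hp ?_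
  rintro _ ⟨g, rfl⟩
  obtain ⟨γ, hγ, h⟩ := h g
  exact ⟨γ, hγ, h.symm⟩

theorem cubeEnvelope_apply {d : ℕ} {P : Cube d → Function.End X} (hP : P ∈ cubeEnvelope G X d)
    (ω : Cube d) : P ω ∈ envelope G X := by
  refine map_mem_closure (f := fun P : Cube d → Function.End X => P ω) (continuous_apply ω) hP ?_
  rintro _ ⟨γ, -, rfl⟩
  exact ⟨γ ω, rfl⟩

theorem face_mem_hostKraGroup {d : ℕ} (h : G) (i : Fin d) (a : Bool) :
    faceElement h {ω : Cube d | ω i = a} ∈ hostKraGroup G d :=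
  Subgroup.subset_closure ⟨h, _, ⟨i, a, rfl⟩, rfl⟩

theorem const_mem_hostKraGroup {d : ℕ} (h : G) :
    (fun _ => h) ∈ hostKraGroup G (d + 1) := by
  convert mul_mem (face_mem_hostKraGroup h (0 : Fin (d + 1)) true)
    (face_mem_hostKraGroup h (0 : Fin (d + 1)) false) using 1
  funext ω
  cases h0 : ω 0 <;> simp [faceElement, mulIndicator, h0]

theorem const_mem_cubeEnvelope {d : ℕ} {p : Function.End X} (hp : p ∈ envelope G X) :
    (fun _ => p) ∈ cubeEnvelope G X (d + 1) :=
  map_mem_cubeEnvelope (f := fun p _ => p) (continuous_pi fun _ => continuous_id)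
    (fun g => ⟨_, const_mem_hostKraGroup g, rfl⟩) hp

open Classical in
theorem face_mem_cubeEnvelope {d : ℕ} {p : Function.End X} (hp : p ∈ envelope G X) (i : Fin d)
    (a : Bool) : (fun ω => if ω i = a then p else 1) ∈ cubeEnvelope G X d := by
  refine map_mem_cubeEnvelope (f := fun p ω => if ω i = a then p else 1)
    (continuous_pi fun ω => ?_) (fun g => ⟨_, face_mem_hostKraGroup g i a, ?_⟩) hp
  · split_ifs
    exacts [continuous_id, continuous_const]
  · funext ω
    by_cases h : ω i = a <;> simp [faceElement, piToEnd, MulAction.toEndHom, h]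

/-- For an idempotent `v`, the element with value `1` at `(1,…,1)` and `v` elsewhere. -/
theorem update_one_mem_cubeEnvelope {d : ℕ} {v : Function.End X} (hv : v ∈ envelope G X)
    (hvv : v * v = v) :
    Function.update (fun _ => v) (fun _ => true) 1 ∈ cubeEnvelope G X d := by
  classical
  -- The vertices other than the top one are the union of the hyperfaces `ω i = false`; on overlaps
  -- `v * v = v` keeps the product equal to `v`.
  have key : ∀ s : Finset (Fin d),
      (fun ω : Cube d => if ∃ i ∈ s, ω i = false then v else 1) ∈ cubeEnvelope G X d := by
    intro s
    induction s using Finset.induction_on with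
    | empty =>
      convert (cubeEnvelope G X d).one_mem using 1
      simp [Pi.one_def]
    | insert i s _ ih =>
      convert mul_mem (face_mem_cubeEnvelope hv i false) ih using 1
      funext ω
      by_cases h1 : ω i = false <;> by_cases h2 : ∃ j ∈ s, ω j = false <;>
        simp [h1, h2, hvv]
  convert key Finset.univ using 1
  funext ω
  by_cases h : ω = fun _ => true
  · subst h; simp
  · have : ∃ i, ω i = false := by
      by_contra! hne
      exact h (funext fun i => by simpa using hne i)
    simp [h, this]

/-- Folding is a homomorphism, and it sends a hyperface generator to itself if `η i = true`, and to
a constant or to `1` otherwise. -/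
theorem comp_inf_mem_hostKraGroup {d : ℕ} {γ : Cube (d + 1) → G}
    (hγ : γ ∈ hostKraGroup G (d + 1)) (η : Cube (d + 1)) :
    (fun ω => γ (ω ⊓ η)) ∈ hostKraGroup G (d + 1) := by
  induction hγ using Subgroup.closure_induction with
  | mem γ h =>
    obtain ⟨h, _, ⟨i, a, rfl⟩, rfl⟩ := h
    cases hη : η i
    · cases a
      · convert const_mem_hostKraGroup h using 1
        funext ω
        simp [faceElement, hη]
      · convert (hostKraGroup G (d + 1)).one_mem using 1
        funext ω
        simp [faceElement, hη]
    · convert face_mem_hostKraGroup h i a using 1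
      funext ω
      simp [faceElement, mulIndicator, hη]
  | one => exact (hostKraGroup G (d + 1)).one_mem
  | mul a b _ _ ha hb => exact mul_mem ha hb
  | inv a _ ha => exact inv_mem ha

theorem comp_inf_mem_cubeEnvelope {d : ℕ} {P : Cube (d + 1) → Function.End X}
    (hP : P ∈ cubeEnvelope G X (d + 1)) (η : Cube (d + 1)) :
    (fun ω => P (ω ⊓ η)) ∈ cubeEnvelope G X (d + 1) := by
  refine map_mem_closure (f := fun (P : Cube (d + 1) → Function.End X) ω => P (ω ⊓ η))
    (continuous_pi fun ω => continuous_apply _) hP ?_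
  rintro _ ⟨γ, hγ, rfl⟩
  exact ⟨_, comp_inf_mem_hostKraGroup hγ η, rfl⟩

theorem smul_mem_dynamicalCubes {d : ℕ} {P : Cube d → Function.End X}
    (hP : P ∈ cubeEnvelope G X d) {c : Cube d → X} (hc : c ∈ dynamicalCubes G X d) :
    P • c ∈ dynamicalCubes G X d := by
  have h1 : ∀ γ ∈ hostKraGroup G d, piToEnd G X (Cube d) γ • c ∈ dynamicalCubes G X d := by
    intro γ hγ
    refine map_mem_closure (f := fun c : Cube d → X => piToEnd G X (Cube d) γ • c)
      (continuous_pi fun ω => (continuous_const_smul (γ ω)).comp (continuous_apply ω)) hc ?_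
    rintro _ ⟨γ', hγ', x, rfl⟩
    exact ⟨γ * γ', mul_mem hγ hγ', x, funext fun ω => (mul_smul _ _ _).symm⟩
  have h2 := map_mem_closure (t := dynamicalCubes G X d) (continuous_pi_smul c) hP (by
    rintro _ ⟨γ, hγ, rfl⟩
    exact h1 γ hγ)
  rwa [dynamicalCubes, closure_closure] at h2

theorem lowerCorner_mem_of_const {d : ℕ} {p : Function.End X} (hp : p ∈ envelope G X) {x y : X}
    (h : lowerCorner (d + 1) x y ∈ dynamicalCubes G X (d + 1)) :
    lowerCorner (d + 1) (p • x) (p • y) ∈ dynamicalCubes G X (d + 1) := by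
  rw [← smul_lowerCorner (fun _ => p) x y p p (Function.update_eq_self _ _).symm]
  exact smul_mem_dynamicalCubes (const_mem_cubeEnvelope hp) h

/-! ### The group of cube elements with coordinates in `uL`. -/

variable [CompactSpace X] [T2Space X]

/-- The compact semigroup of multiples `q * P` contains an idempotent, whose coordinates lie in `L`
and so act as right identities there. Hence `u * q * u` is a left inverse of `P`, and left inverses
throughout give two-sided ones. -/
theorem exists_inverse {L : Set (Function.End X)} (hL : IsMinimalLeftIdeal (envelope G X) L)
    {u : Function.End X} (hu : u ∈ L) (huu : u * u = u) {d : ℕ}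
    {P : Cube (d + 1) → Function.End X} (hP : P ∈ cubeEnvelope G X (d + 1))
    (hPL : ∀ ω, P ω ∈ L) (huP : ∀ ω, u * P ω = P ω) :
    ∃ Q ∈ cubeEnvelope G X (d + 1), (∀ ω, Q ω ∈ L) ∧ (∀ ω, u * Q ω = Q ω) ∧
      (∀ ω, Q ω * P ω = u) ∧ ∀ ω, P ω * Q ω = u := by
  have left : ∀ P ∈ cubeEnvelope G X (d + 1), (∀ ω, P ω ∈ L) → (∀ ω, u * P ω = P ω) →
      ∃ Q ∈ cubeEnvelope G X (d + 1), (∀ ω, Q ω ∈ L) ∧ (∀ ω, u * Q ω = Q ω) ∧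
        (∀ ω, Q ω * P ω = u) := by
    intro P hP hPL huP
    obtain ⟨_, ⟨q, hq, rfl⟩, he⟩ := exists_idempotent_in_compact_subsemigroup
      continuous_pi_mul_right ((· * P) '' (cubeEnvelope G X (d + 1) : Set _))
      ⟨_, 1, one_mem _, rfl⟩
      ((isClosed_cubeEnvelope (d + 1)).isCompact.image (continuous_pi_mul_right P))
      (by
        rintro _ ⟨a, ha, rfl⟩ _ ⟨b, hb, rfl⟩
        exact ⟨a * P * b, mul_mem (mul_mem ha hP) hb, by simp only [mul_assoc]⟩)
    have huE := const_mem_cubeEnvelope (d := d) (hL.subset hu)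
    have hqu : ∀ ω, q ω * u ∈ L := fun ω => hL.mul_mem _ (cubeEnvelope_apply hq ω) _ hu
    refine ⟨(fun _ => u) * q * fun _ => u, mul_mem (mul_mem huE hq) huE, fun ω => ?_, fun ω => ?_,
      fun ω => ?_⟩
    · simpa [mul_assoc] using hL.mul_mem u (hL.subset hu) _ (hqu ω)
    · simp only [Pi.mul_apply, ← mul_assoc, huu]
    · have h1 : q ω * P ω ∈ L := hL.mul_mem _ (cubeEnvelope_apply hq ω) _ (hPL ω)
      simp only [Pi.mul_apply, mul_assoc, huP]
      exact hL.mul_idempotent h1 (congrFun he ω) hu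
  obtain ⟨Q, hQ, hQL, huQ, hQP⟩ := left P hP hPL huP
  obtain ⟨R, -, hRL, -, hRQ⟩ := left Q hQ hQL huQ
  refine ⟨Q, hQ, hQL, huQ, hQP, fun ω => ?_⟩
  have : R ω = P ω := by
    rw [← huP ω, ← hRQ ω, mul_assoc, hQP, hL.mul_idempotent hu huu (hRL ω)]
  rw [← this, hRQ]

/-- Elements with coordinates in the group `uL` that fix `y` away from `(1,…,1)` can be made
trivial away from `(1,…,1)` without changing their action on the constant configuration `y`. -/
theorem exists_eq_idempotent_of_fixes {L : Set (Function.End X)}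
    (hL : IsMinimalLeftIdeal (envelope G X) L) {u : Function.End X} (hu : u ∈ L)
    (huu : u * u = u) {d : ℕ} {y : X} (hy : u • y = y) {P : Cube (d + 1) → Function.End X}
    (hP : P ∈ cubeEnvelope G X (d + 1)) (hPL : ∀ ω, P ω ∈ L) (huP : ∀ ω, u * P ω = P ω)
    (T : Finset (Cube (d + 1))) (hT : IsLowerSet (T : Set (Cube (d + 1))))
    (hPT : ∀ ω ∈ T, P ω • y = y) :
    ∃ Q ∈ cubeEnvelope G X (d + 1), (∀ ω, Q ω ∈ L) ∧ (∀ ω, u * Q ω = Q ω) ∧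
      (∀ ω ∈ T, Q ω = u) ∧ ∀ ω, Q ω • y = P ω • y := by
  classical
  induction h : T.card generalizing T with
  | zero =>
    rw [Finset.card_eq_zero] at h
    exact ⟨P, hP, hPL, huP, by simp [h], fun _ => rfl⟩
  | succ k ih =>
    obtain ⟨η, hη⟩ := T.exists_maximal (Finset.card_pos.1 (by omega))
    have hT' : IsLowerSet ((T.erase η : Finset _) : Set (Cube (d + 1))) := by
      intro a b hba ha
      simp only [Finset.coe_erase, mem_sdiff, Finset.mem_coe, mem_singleton_iff] at ha ⊢
      refine ⟨hT hba ha.1, ?_⟩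
      rintro rfl
      exact ha.2 (le_antisymm (hη.2 ha.1 hba) hba)
    obtain ⟨Q, hQ, hQL, huQ, hQT, hQy⟩ := ih (T.erase η) hT'
      (fun ω hω => hPT ω (Finset.mem_of_mem_erase hω))
      (by rw [Finset.card_erase_of_mem hη.1, h]; rfl)
    -- `R` inverts the folded `Q`: it cancels `Q` at `η`, equals `u` on the rest of `T` because `ω ⊓
    -- η` is then in `T` and differs from `η`, and fixes `y` at every vertex.
    obtain ⟨R, hR, hRL, huR, hRQ, hQR⟩ := exists_inverse hL hu huu
      (comp_inf_mem_cubeEnvelope hQ η) (fun _ => hQL _) (fun _ => huQ _)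
    have hRu : ∀ ω, Q (ω ⊓ η) = u → R ω = u := fun ω hω => by
      have := hRQ ω
      rwa [hω, hL.mul_idempotent hu huu (hRL ω)] at this
    have hQηy : Q η • y = y := (hQy η).trans (hPT η hη.1)
    have hRy : ∀ ω, R ω • y = y := fun ω => by
      have : Q (ω ⊓ η) • y = y := by
        by_cases hω : ω ⊓ η = η
        · rw [hω, hQηy]
        · rw [hQT _ (Finset.mem_erase.2 ⟨hω, hT inf_le_right hη.1⟩), hy]
      calc R ω • y = R ω • Q (ω ⊓ η) • y := by rw [this]
        _ = y := by rw [← mul_smul, hRQ, hy]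
    refine ⟨Q * R, mul_mem hQ hR, fun ω => hL.mul_mem _ (cubeEnvelope_apply hQ ω) _ (hRL ω),
      fun ω => ?_, fun ω hω => ?_, fun ω => ?_⟩
    · rw [Pi.mul_apply, ← mul_assoc, huQ]
    · rw [Pi.mul_apply]
      by_cases hωη : ω = η
      · subst hωη
        simpa using hQR ω
      · have hinf : ω ⊓ η ≠ η := fun h' => hωη
          (le_antisymm (hη.2 hω (inf_eq_right.1 h')) (inf_eq_right.1 h'))
        rw [hQT ω (Finset.mem_erase.2 ⟨hωη, hω⟩),
          hRu ω (hQT _ (Finset.mem_erase.2 ⟨hinf, hT inf_le_right hη.1⟩)), huu]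
    · rw [Pi.mul_apply, mul_smul, hRy, hQy]

/-! ### Minimal actions and the equivalence relation. -/

variable [MulAction.IsMinimal G X]

theorem exists_smul_eq_of_leftIdeal {L : Set (Function.End X)} (hL : IsClosed L)
    (hne : L.Nonempty) (hmul : ∀ p ∈ envelope G X, ∀ q ∈ L, p * q ∈ L) (x y : X) :
    ∃ p ∈ L, p • x = y := by
  have h := eq_univ_of_isClosed_of_smul_mem (G := G) (A := (fun p : Function.End X => p • x) '' L)
    ((continuous_end_smul x).isClosedMap _ hL) (hne.image _) (by
      rintro g _ ⟨p, hp, rfl⟩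
      exact ⟨_, hmul _ (subset_closure ⟨g, rfl⟩) p hp, rfl⟩)
  exact h.ge (mem_univ y)

/-- The orbit of the constant `y` under the envelope is compact, and by minimality it contains every
`γ x^[d+1]`. -/
theorem exists_cubeEnvelope_smul_eq {d : ℕ} {c : Cube (d + 1) → X}
    (hc : c ∈ dynamicalCubes G X (d + 1)) (y : X) :
    ∃ P ∈ cubeEnvelope G X (d + 1), P • (fun _ => y) = c := by
  have hcl := (continuous_pi_smul fun _ : Cube (d + 1) => y).isClosedMap _
    (isClosed_cubeEnvelope (G := G) (X := X) (d + 1))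
  refine closure_minimal ?_ hcl hc
  rintro _ ⟨γ, hγ, x, rfl⟩
  obtain ⟨p, hp, rfl⟩ := exists_smul_eq_of_leftIdeal (G := G) isClosed_envelope
    ⟨1, one_mem _⟩ (fun p hp q hq => mul_mem hp hq) y x
  exact ⟨piToEnd G X _ γ * fun _ => p,
    mul_mem (subset_closure ⟨γ, hγ, rfl⟩) (const_mem_cubeEnvelope hp), rfl⟩

theorem exists_idempotent_smul_eq {L : Set (Function.End X)}
    (hL : IsMinimalLeftIdeal (envelope G X) L) (x : X) : ∃ v ∈ L, v * v = v ∧ v • x = x := by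
  obtain ⟨v, ⟨hv, hvx⟩, hvv⟩ := exists_idempotent_in_compact_subsemigroup
    continuous_end_mul_right (L ∩ {p : Function.End X | p • x = x})
    (exists_smul_eq_of_leftIdeal hL.isClosed hL.nonempty hL.mul_mem x x)
    (hL.isClosed.inter (isClosed_singleton.preimage (continuous_end_smul x))).isCompact
    (by
      rintro p ⟨hp, hpx⟩ q ⟨hq, hqx⟩
      refine ⟨hL.mul_mem p (hL.subset hp) q hq, ?_⟩
      change (p * q) • x = x
      rw [mul_smul, show q • x = x from hqx, show p • x = x from hpx])
  exact ⟨v, hv, hvv, hvx⟩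

theorem lowerCorner_mem_iff_idempotent_smul {L : Set (Function.End X)}
    (hL : IsMinimalLeftIdeal (envelope G X) L) {u : Function.End X} (hu : u ∈ L)
    (huu : u * u = u) {d : ℕ} {x y : X} :
    lowerCorner (d + 1) (u • x) (u • y) ∈ dynamicalCubes G X (d + 1) ↔
      lowerCorner (d + 1) x y ∈ dynamicalCubes G X (d + 1) := by
  refine ⟨fun h => ?_, lowerCorner_mem_of_const (hL.subset hu)⟩
  obtain ⟨v, hv, hvv, hvx⟩ := exists_idempotent_smul_eq hL x
  obtain ⟨w, hw, hww, hwy⟩ := exists_idempotent_smul_eq hL y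
  -- Since `w * u = w`, applying `w` everywhere gives the corner of `w • x` and `y`; then `v` off
  -- the top vertex restores `x`, as `v * w = v`.
  have h1 := lowerCorner_mem_of_const (hL.subset hw) h
  have h2 := smul_mem_dynamicalCubes (update_one_mem_cubeEnvelope (hL.subset hv) hvv) h1
  rwa [smul_lowerCorner _ _ _ v 1 rfl, ← mul_smul w u x, ← mul_smul w u y,
    hL.mul_idempotent hu huu hw, ← mul_smul v w x, hL.mul_idempotent hw hww hv, hvx, hwy,
    one_smul] at h2

theorem lowerCorner_mem_iff_exists {L : Set (Function.End X)}
    (hL : IsMinimalLeftIdeal (envelope G X) L) {u : Function.End X} (hu : u ∈ L)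
    (huu : u * u = u) {d : ℕ} {y z : X} (hy : u • y = y) (hz : u • z = z) :
    lowerCorner (d + 1) y z ∈ dynamicalCubes G X (d + 1) ↔
      ∃ q ∈ L, u * q = q ∧
        Function.update (fun _ => u) (fun _ => true) q ∈ cubeEnvelope G X (d + 1) ∧
        q • y = z := by
  constructor
  · intro h
    obtain ⟨P, hP, hPy⟩ := exists_cubeEnvelope_smul_eq h y
    have huE := const_mem_cubeEnvelope (d := d) (hL.subset hu)
    have hval : ∀ ω, ((fun _ => u) * P * fun _ => u : Cube (d + 1) → Function.End X) ω • y =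
        lowerCorner (d + 1) y z ω := fun ω => by
      rw [Pi.mul_apply, Pi.mul_apply, mul_smul, mul_smul, hy, show P ω • y = _ from congrFun hPy ω]
      by_cases hω : ω = fun _ => true
      · subst hω; simp [lowerCorner, -Function.End.smul_def, hz]
      · simp [lowerCorner, hω, -Function.End.smul_def, hy]
    -- Multiplying `P` by `u` on both sides puts its coordinates in `uL` without changing its action
    -- on `y`.
    obtain ⟨Q, hQ, hQL, huQ, hQT, hQy⟩ := exists_eq_idempotent_of_fixes hL hu huu hy
      (P := (fun _ => u) * P * fun _ => u)
      (mul_mem (mul_mem huE hP) huE)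
      (fun ω => hL.mul_mem _ (mul_mem (hL.subset hu) (cubeEnvelope_apply hP ω)) _ hu)
      (fun ω => by simp only [Pi.mul_apply, ← mul_assoc, huu])
      (Finset.univ.erase fun _ => true)
      (by
        intro a b hba ha
        simp only [Finset.coe_erase, Finset.coe_univ, mem_sdiff, mem_univ, true_and,
          mem_singleton_iff] at ha ⊢
        rintro rfl
        exact ha (top_le_iff.1 hba))
      (fun ω hω => by rw [hval]; simp [lowerCorner, Finset.ne_of_mem_erase hω])
    refine ⟨Q fun _ => true, hQL _, huQ _, ?_, by rw [hQy, hval]; simp [lowerCorner]⟩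
    convert hQ using 1
    funext ω
    by_cases hω : ω = fun _ => true
    · subst hω; simp
    · simp [hω, hQT ω (Finset.mem_erase.2 ⟨hω, Finset.mem_univ _⟩)]
  · rintro ⟨q, -, -, hq, rfl⟩
    have := smul_mem_dynamicalCubes hq (const_mem_dynamicalCubes (G := G) (d + 1) y)
    rwa [smul_const_eq_lowerCorner, hy] at this

variable (G X) in
theorem equivalence_lowerCorner_mem (d : ℕ) :
    Equivalence fun x y : X => lowerCorner (d + 1) x y ∈ dynamicalCubes G X (d + 1) := by
  obtain ⟨L, hL⟩ := exists_isMinimalLeftIdeal continuous_end_mul_right (envelope G X)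
    isClosed_envelope
  obtain ⟨u, hu, huu⟩ := exists_idempotent_in_compact_subsemigroup continuous_end_mul_right L
    hL.nonempty hL.isClosed.isCompact fun p hp q hq => hL.mul_mem p (hL.subset hp) q hq
  have hfix : ∀ x : X, u • u • x = u • x := fun x => by rw [← mul_smul, huu]
  refine ⟨fun x => ?_, fun {x y} h => ?_, fun {x y z} h h' => ?_⟩
  · rw [lowerCorner, Function.update_eq_self_iff.2 rfl]
    exact const_mem_dynamicalCubes _ x
  · rw [← lowerCorner_mem_iff_idempotent_smul hL hu huu,
      lowerCorner_mem_iff_exists hL hu huu (hfix _) (hfix _)] at h ⊢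
    obtain ⟨q, hqL, huq, hq, hqx⟩ := h
    -- Symmetry is inversion: `R` is again `u` off the top vertex.
    obtain ⟨R, hR, hRL, huR, hRQ, -⟩ := exists_inverse hL hu huu hq
      (fun ω => by by_cases hω : ω = fun _ => true <;> simp [hω, hu, hqL])
      (fun ω => by by_cases hω : ω = fun _ => true <;> simp [hω, huu, huq])
    refine ⟨R fun _ => true, hRL _, huR _, ?_, ?_⟩
    · convert hR using 1
      funext ω
      by_cases hω : ω = fun _ => true
      · subst hω; simp
      · have := hRQ ω
        rw [Function.update_of_ne hω, hL.mul_idempotent hu huu (hRL ω)] at this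
        simp [hω, this]
    · have := hRQ fun _ => true
      rw [Function.update_self] at this
      rw [← hqx, ← mul_smul, this, hfix]
  · rw [← lowerCorner_mem_iff_idempotent_smul hL hu huu,
      lowerCorner_mem_iff_exists hL hu huu (hfix _) (hfix _)] at h h' ⊢
    obtain ⟨q, hqL, huq, hq, hqx⟩ := h
    obtain ⟨r, hrL, hur, hr, hry⟩ := h'
    -- Transitivity is multiplication.
    refine ⟨r * q, hL.mul_mem r (hL.subset hrL) q hqL, by rw [← mul_assoc, hur], ?_, ?_⟩
    · convert mul_mem hr hq using 1
      funext ω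
      by_cases hω : ω = fun _ => true
      · subst hω; simp
      · simp [hω, huu]
    · rw [mul_smul, hqx, hry]

end Envelope

end NilpotentRP

theorem mainTheorem1 {G X : Type*} [Group G] [TopologicalSpace G] [IsTopologicalGroup G]
    [TopologicalSpace X] [CompactSpace X] [T2Space X] [MulAction G X] [ContinuousSMul G X]
    [MulAction.IsMinimal G X] (d : ℕ) (hd : 1 ≤ d) :
    IsClosed (NilpotentRP.NRP G X d) ∧
      (∀ (g : G) (x y : X),
        (g • x, g • y) ∈ NilpotentRP.NRP G X d ↔ (x, y) ∈ NilpotentRP.NRP G X d) ∧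
      Equivalence (fun x y : X => (x, y) ∈ NilpotentRP.NRP G X d) := by
  have hsmul : ∀ (g : G) (x y : X), (x, y) ∈ NilpotentRP.NRP G X d →
      (g • x, g • y) ∈ NilpotentRP.NRP G X d := fun g x y h =>
    NilpotentRP.lowerCorner_mem_of_const (subset_closure ⟨g, rfl⟩) h
  refine ⟨?_, fun g x y => ⟨fun h => ?_, hsmul g x y⟩,
    NilpotentRP.equivalence_lowerCorner_mem G X d⟩
  · exact isClosed_closure.preimage (Continuous.update
      (continuous_pi fun _ => continuous_fst) _ continuous_snd)
  · simpa using hsmul g⁻¹ _ _ h
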